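/- Let $\mathbb F$ be $\mathbb R$ or $\mathbb C$ and let $f:\mathbb F^{m\times m}\to\mathbb F^{m\times m}$ satisfy, for all matrices $M,N$ and all $a\in\mathbb F$: $f(f(M))=M$, $f(MN)=f(N)f(M)$, $f(M+N)=f(M)+f(N)$ and $f(aM)=s(a)f(M)$, where $s:\mathbb F\to\mathbb F$ is injective; suppose also that $f$ maps invertible matrices to invertible matrices. For a pencil $D-\lambda E$ of $m\times m$ matrices over $\mathbb F$: it is regular if $\det(D-\lambda E)\neq0$ for some $\lambda\in\mathbb F$; its spectrum $\sigma(D-\lambda E)\subseteq\mathbb C\cup\{\infty\}$ consists of the $z\in\mathbb C$ with $\det(D-zE)=0$, together with $\infty$ if $E$ is singular; its relative characteristic polynomial is $\mathrm{ch}_{D,E}(\lambda)=\det(D-\lambda E)=\sum_{j=0}^m p_j\lambda^j$; and for a family $(W_k)_{k\in\mathbb Z}$ of $m\times m$ matrices put $\mathrm{ch}_{D,E}(W_k)=\sum_{j=0}^m p_jW_{k+j-m}$. Let $A,B,C\in\mathbb F^{m\times m}$. Assume that the pencils $A-\lambda f(B)$ and $B-\lambda f(A)$ are regular, that $\sigma(A-\lambda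 f(B))\cap\sigma(B-\lambda f(A))=\emptyset$, and that $A$ is nonsingular. Then there are integers $\mu_1,\mu_2\ge0$ and matrices $U_k$ ($k\ge-\mu_1$), $V_k$ ($k\ge-\mu_2$) such that, for all $\lambda\in\mathbb F$ of sufficiently large modulus, $$(A-\lambda f(B))^{-1}=\frac1\lambda\sum_{k=-\mu_1}^\infty U_k\lambda^{-k},\qquad (B-\lambda f(A))^{-1}=\frac1\lambda\sum_{k=-\mu_2}^\infty V_k\lambda^{-k}.$$ For any such expansions put $U_k=0$ for $k<-\mu_1$, $V_k=0$ for $k<-\mu_2$, and $$T_k=\sum_{\substack{s+t=k-1\\ s\ge-\mu_1,\ t\ge-\mu_2}}U_s\,C\,V_t-\sum_{\substack{s+t=k\\ s\ge-\mu_1,\ t\ge-\mu_2}}U_s\,f(C)\,V_t ,$$ and let $p_0,\dots,p_m$ be the coefficients of $\mathrm{ch}_{A,f(B)}(\lambda)=\det(A-\lambda f(B))=\sum_{j=0}^mp_j\lambda^j$. Then the matrix $\mathrm{ch}_{A,f(B)}(V_m)=\sum_{j=0}^mp_jV_j$ is nonsingular, and the equation $AX+f(X)B=C$ has exactly one solution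 $X\in\mathbb F^{m\times m}$, namely $$X=\Big(\sum_{j=0}^mp_jT_j\Big)\big(\mathrm{ch}_{A,f(B)}(V_m)\big)^{-1}.$$ -/

import Mathlib

open Polynomial

noncomputable section

/-- The pencil `D - λ E` is regular: `det (D - λ E) ≠ 0` for some scalar `λ` of the base field. -/
def PencilRegular {𝕂 : Type*} [Field 𝕂] {m : ℕ} (D E : Matrix (Fin m) (Fin m) 𝕂) : Prop :=
  ∃ z : 𝕂, (D - z • E).det ≠ 0

/-- The relative characteristic polynomial `ch_{D,E}(λ) = det (D - λ E)`. -/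
def relCharpoly {𝕂 : Type*} [Field 𝕂] {m : ℕ} (D E : Matrix (Fin m) (Fin m) 𝕂) : 𝕂[X] :=
  (D.map (C : 𝕂 →+* 𝕂[X]) - (X : 𝕂[X]) • E.map (C : 𝕂 →+* 𝕂[X])).det

/-- The spectrum of the pencil `D - λ E`, as a subset of the algebraic closure of the base field
together with a point `∞`.  Over `ℝ` and over `ℂ` the algebraic closure is the field of complex
numbers, so this is the usual set of finite and infinite complex generalized eigenvalues; `∞` is
an eigenvalue exactly when `E` is singular. -/
def pencilSpectrum {𝕂 : Type*} [Field 𝕂] {m : ℕ} (D E : Matrix (Fin m) (Fin m) 𝕂) :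
    Set (OnePoint (AlgebraicClosure 𝕂)) :=
  {w | (w = OnePoint.infty ∧ E.det = 0) ∨
    ∃ z : AlgebraicClosure 𝕂, w = (z : OnePoint (AlgebraicClosure 𝕂)) ∧
      (D.map (algebraMap 𝕂 (AlgebraicClosure 𝕂))
        - z • E.map (algebraMap 𝕂 (AlgebraicClosure 𝕂))).det = 0}

/-- The `U k` are the Laurent coefficients of the resolvent of the pencil `D - λ E`, that is
`(D - λ E)⁻¹ = λ⁻¹ ∑_{k ≥ -μ} λ^(-k) U k` for all scalars `λ` of large modulus (the series has
finitely many nonnegative powers of `λ` and in general infinitely many negative ones). -/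
structure IsLaurentExpansion {𝕂 : Type*} [RCLike 𝕂] {m : ℕ} (D E : Matrix (Fin m) (Fin m) 𝕂)
    (μ : ℕ) (U : ℤ → Matrix (Fin m) (Fin m) 𝕂) : Prop where
  eq_zero : ∀ k : ℤ, k < -(μ : ℤ) → U k = 0
  hasSum : ∃ R : ℝ, ∀ z : 𝕂, R < ‖z‖ →
    IsUnit (D - z • E) ∧ HasSum (fun k : ℤ => z ^ (-k - 1) • U k) (D - z • E)⁻¹

/-- `ch_{D,E}(W_k) = ∑_{j=0}^m p_j W_{k+j-m}`, where `ch_{D,E}(λ) = ∑_{j=0}^m p_j λ^j`. -/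
def relCharEval {𝕂 : Type*} [Field 𝕂] {m : ℕ} (D E : Matrix (Fin m) (Fin m) 𝕂)
    (W : ℤ → Matrix (Fin m) (Fin m) 𝕂) (k : ℤ) : Matrix (Fin m) (Fin m) 𝕂 :=
  ∑ j ∈ Finset.range (m + 1), (relCharpoly D E).coeff j • W (k + j - m)

/-- `∑_{s + t = k, s ≥ -μ₁, t ≥ -μ₂} U_s M V_t`. -/
def convCoeff {𝕂 : Type*} [Field 𝕂] {m : ℕ} (μ₁ μ₂ : ℕ)
    (U V : ℤ → Matrix (Fin m) (Fin m) 𝕂) (M : Matrix (Fin m) (Fin m) 𝕂) (k : ℤ) :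
    Matrix (Fin m) (Fin m) 𝕂 :=
  ∑ s ∈ Finset.Icc (-(μ₁ : ℤ)) (k + μ₂), U s * M * V (k - s)

/-- `T_k = ∑_{s + t = k - 1} U_s M V_t - ∑_{s + t = k} U_s N V_t`: the coefficient of `λ^(-k-1)` in
`(∑_s U_s λ^(-s-1)) (M - λ N) (∑_t V_t λ^(-t-1))`. -/
def rhsCoeff {𝕂 : Type*} [Field 𝕂] {m : ℕ} (μ₁ μ₂ : ℕ)
    (U V : ℤ → Matrix (Fin m) (Fin m) 𝕂) (M N : Matrix (Fin m) (Fin m) 𝕂) (k : ℤ) :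
    Matrix (Fin m) (Fin m) 𝕂 :=
  convCoeff μ₁ μ₂ U V M (k - 1) - convCoeff μ₁ μ₂ U V N k

end

/-! Write E = f(B), F = f(A). Applying f to AX + f(X)B = C gives EX + f(X)F = f(C), so (X, f(X))
solves the coupled system AX + YB = C, EX + YF = f(C), which is linear in (X, Y). Equivalently (A -
λE)X + Y(B - λF) = C - λf(C); multiplying by both resolvents and comparing Laurent coefficients
yields T_k = X V_k + U_k Y (`rhsCoeff_eq`).

Cayley–Hamilton for A⁻¹E gives ∑ p_j U_j = 0, hence ∑ p_j T_j = X ∑ p_j V_j. As F is invertible, V_j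
= -(F⁻¹B)^j F⁻¹, so ∑ p_j V_j = -ch(F⁻¹B) F⁻¹; this is invertible because disjoint spectra make ch
coprime to the characteristic polynomial of F⁻¹B. So X is determined.

For existence, the coupled system is injective, hence surjective by dimension. If (X, Y) solves it,
so does (f(Y), f(X)); uniqueness forces X = f(Y), and X solves the original equation. -/

/-! ### Laurent coefficients at infinity: uniqueness and recurrences. -/

/-- A Laurent series in `z⁻¹` with finitely many positive powers that sums to zero near infinity
vanishes. -/
theorem laurent_coeff_eq_zero {𝕂 : Type*} [RCLike 𝕂] {μ : ℤ} {w : ℤ → 𝕂}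
    (hw : ∀ k < μ, w k = 0) {R : ℝ}
    (h : ∀ z : 𝕂, R < ‖z‖ → HasSum (fun k : ℤ => z ^ (-k - 1) * w k) 0) : w = 0 := by
  set c : ℕ → 𝕂 := fun n => w (n + μ) with hc
  have key : ∀ y : 𝕂, y ≠ 0 → R < ‖y⁻¹‖ → HasSum (fun n : ℕ => y ^ n * c n) 0 := by
    intro y hy hR
    -- With z = y⁻¹, the factor y^(-μ-1) turns z^(-k-1) into y^(k-μ), an ordinary power series in y.
    have h1 := (h _ hR).mul_left (y ^ (-μ - 1))
    rw [mul_zero] at h1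
    have hinj : Function.Injective (fun n : ℕ => (n : ℤ) + μ) := fun a b hab => by
      simpa using hab
    rw [← hinj.hasSum_iff] at h1
    · refine Eq.mp (congrArg (HasSum · _) (funext fun n => ?_)) h1
      simp only [Function.comp, hc, inv_zpow', ← mul_assoc]
      rw [← zpow_add₀ hy, ← zpow_natCast]
      congr 2
      ring
    · intro k hk
      have : k < μ := by
        by_contra hlt
        exact hk ⟨(k - μ).toNat, by simp; omega⟩
      simp [hw k this]
  set p : FormalMultilinearSeries 𝕂 𝕂 𝕂 := FormalMultilinearSeries.ofScalars 𝕂 c with hp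
  have hpc : ∀ n, p.coeff n = c n := fun n => by simp [hp, FormalMultilinearSeries.coeff_ofScalars]
  classical
  -- `key` says nothing at y = 0, where the series sums to c 0. Analyticity of g, which vanishes off
  -- 0, then forces c 0 = 0 as well.
  let g : 𝕂 → 𝕂 := fun y => if y = 0 then c 0 else 0
  have hev : ∀ᶠ y : 𝕂 in nhdsWithin 0 {0}ᶜ, R < ‖y⁻¹‖ :=
    (tendsto_norm_cobounded_atTop.comp Filter.tendsto_inv₀_nhdsNE_zero).eventually_gt_atTop R
  have hg : HasFPowerSeriesAt g p 0 := by
    rw [hasFPowerSeriesAt_iff]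
    filter_upwards [eventually_nhdsWithin_iff.1 hev] with y hy
    simp only [hpc, smul_eq_mul, zero_add, g]
    split_ifs with h0
    · subst h0
      simpa using hasSum_single (f := fun n : ℕ => (0 : 𝕂) ^ n * c n) 0
        (fun n hn => by simp [hn])
    · exact key y h0 (hy h0)
  have hgz : g =ᶠ[nhds 0] 0 := by
    refine (hg.analyticAt.frequently_zero_iff_eventually_zero).1 (Filter.Eventually.frequently ?_)
    filter_upwards [self_mem_nhdsWithin] with y hy
    simp only [g, if_neg (show y ≠ 0 from hy)]
  have hp0 : p = 0 := (hg.congr hgz).eq_zero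
  have hc0 : ∀ n, c n = 0 := fun n => by rw [← hpc, hp0]; simp [FormalMultilinearSeries.coeff]
  funext k
  by_cases hk : k < μ
  · exact hw k hk
  · have := hc0 (k - μ).toNat
    simp only [hc] at this
    rwa [show ((k - μ).toNat : ℤ) + μ = k by omega] at this

/-- Matrix version of `laurent_coeff_eq_zero`. -/
theorem laurent_matrix_coeff_eq_zero {𝕂 : Type*} [RCLike 𝕂] {m : ℕ} {μ : ℤ}
    {W : ℤ → Matrix (Fin m) (Fin m) 𝕂} (hW : ∀ k < μ, W k = 0) {R : ℝ}
    (h : ∀ z : 𝕂, R < ‖z‖ → HasSum (fun k : ℤ => z ^ (-k - 1) • W k) 0) : W = 0 := by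
  funext k
  ext i j
  have := laurent_coeff_eq_zero (w := fun k => W k i j) (μ := μ) (R := R)
    (fun k hk => by simp [hW k hk])
    (fun z hz => by
      have h1 := h z hz
      exact Pi.hasSum.1 (Pi.hasSum.1 h1 i) j)
  exact congrFun this k

/-- If `∑ z^(-k-1) VD k - z ∑ z^(-k-1) VE k = 1` near infinity, then the coefficients satisfy
`VD k - VE (k + 1) = 0` except for `k = -1`, where the difference is `1`. -/
theorem laurent_coeff_recurrence {𝕂 : Type*} [RCLike 𝕂] {m : ℕ} {μ : ℕ} {R : ℝ}
    {VD VE : ℤ → Matrix (Fin m) (Fin m) 𝕂}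
    (hD : ∀ k < -(μ : ℤ), VD k = 0) (hE : ∀ k < -(μ : ℤ), VE k = 0)
    (hsum : ∀ z : 𝕂, R < ‖z‖ → ∃ S T : Matrix (Fin m) (Fin m) 𝕂,
      HasSum (fun k : ℤ => z ^ (-k - 1) • VD k) S ∧
      HasSum (fun k : ℤ => z ^ (-k - 1) • VE k) T ∧ S - z • T = 1) (k : ℤ) :
    VD k - VE (k + 1) = if k = -1 then 1 else 0 := by
  have := laurent_matrix_coeff_eq_zero (R := max R 0) (μ := -(μ : ℤ) - 1)
    (W := fun k => VD k - VE (k + 1) - if k = -1 then 1 else 0) (fun k hk => by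
      rw [hD k (by omega), hE (k + 1) (by omega), if_neg (by omega)]; simp) (fun z hz => by
      obtain ⟨S, T, hS, hT, hST⟩ := hsum z ((le_max_left _ _).trans_lt hz)
      have hz0 : z ≠ 0 := by
        rintro rfl
        simp at hz
      have h1 : HasSum (fun k : ℤ => z ^ (-k - 1) • VE (k + 1)) (z • T) := by
        rw [← (Equiv.addRight (-1 : ℤ)).hasSum_iff]
        convert hT.const_smul z using 2 with k
        simp only [Function.comp, Equiv.coe_addRight, smul_smul]
        rw [← zpow_one_add₀ hz0]
        congr 2 <;> ring
      have h2 : HasSum (fun k : ℤ => z ^ (-k - 1) •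
          (if k = -1 then (1 : Matrix (Fin m) (Fin m) 𝕂) else 0)) 1 := by
        convert hasSum_single (-1 : ℤ) _ using 1
        · simp
        · intro k hk
          simp [hk]
      have := (hS.sub h1).sub h2
      rw [hST, sub_self] at this
      simpa only [smul_sub] using this)
  simpa [sub_eq_zero] using congrFun this k

theorem IsLaurentExpansion.left_recurrence {𝕂 : Type*} [RCLike 𝕂] {m μ : ℕ}
    {D E : Matrix (Fin m) (Fin m) 𝕂} {V : ℤ → Matrix (Fin m) (Fin m) 𝕂}
    (h : IsLaurentExpansion D E μ V) (k : ℤ) :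
    D * V k - E * V (k + 1) = if k = -1 then 1 else 0 := by
  obtain ⟨R, hR⟩ := h.hasSum
  refine laurent_coeff_recurrence (μ := μ) (R := R) (VD := fun k => D * V k)
    (VE := fun k => E * V k)
    (fun k hk => by simp [h.eq_zero k hk]) (fun k hk => by simp [h.eq_zero k hk])
    (fun z hz => ?_) k
  obtain ⟨hu, hs⟩ := hR z hz
  refine ⟨_, _, by simpa using hs.mul_left D, by simpa using hs.mul_left E, ?_⟩
  rw [← smul_mul_assoc, ← sub_mul]
  exact Matrix.mul_nonsing_inv _ ((Matrix.isUnit_iff_isUnit_det _).1 hu)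

theorem IsLaurentExpansion.right_recurrence {𝕂 : Type*} [RCLike 𝕂] {m μ : ℕ}
    {D E : Matrix (Fin m) (Fin m) 𝕂} {V : ℤ → Matrix (Fin m) (Fin m) 𝕂}
    (h : IsLaurentExpansion D E μ V) (k : ℤ) :
    V k * D - V (k + 1) * E = if k = -1 then 1 else 0 := by
  obtain ⟨R, hR⟩ := h.hasSum
  refine laurent_coeff_recurrence (μ := μ) (R := R) (VD := fun k => V k * D)
    (VE := fun k => V k * E)
    (fun k hk => by simp [h.eq_zero k hk]) (fun k hk => by simp [h.eq_zero k hk])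
    (fun z hz => ?_) k
  obtain ⟨hu, hs⟩ := hR z hz
  refine ⟨_, _, by simpa using hs.mul_right D, by simpa using hs.mul_right E, ?_⟩
  rw [← mul_smul_comm, ← mul_sub]
  exact Matrix.nonsing_inv_mul _ ((Matrix.isUnit_iff_isUnit_det _).1 hu)

/-! ### The relative characteristic polynomial and Cayley–Hamilton. -/

theorem relCharpoly_map {𝕂 L : Type*} [Field 𝕂] [Field L] (φ : 𝕂 →+* L) {m : ℕ}
    (D E : Matrix (Fin m) (Fin m) 𝕂) (z : L) :
    (relCharpoly D E).eval₂ φ z = (D.map φ - z • E.map φ).det := by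
  rw [relCharpoly, ← coe_eval₂RingHom, RingHom.map_det]
  congr 1
  ext i j
  simp [mul_comm z]

theorem relCharpoly_eval {𝕂 : Type*} [Field 𝕂] {m : ℕ}
    (D E : Matrix (Fin m) (Fin m) 𝕂) (z : 𝕂) :
    (relCharpoly D E).eval z = (D - z • E).det := by
  have := relCharpoly_map (RingHom.id 𝕂) D E z
  simpa [eval₂_id] using this

theorem PencilRegular.relCharpoly_ne_zero {𝕂 : Type*} [Field 𝕂] {m : ℕ}
    {D E : Matrix (Fin m) (Fin m) 𝕂} (h : PencilRegular D E) : relCharpoly D E ≠ 0 := by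
  obtain ⟨z, hz⟩ := h
  intro h0
  rw [← relCharpoly_eval, h0] at hz
  simp at hz

/-- For invertible `D` the relative characteristic polynomial is a scaled reversed characteristic
polynomial. -/
theorem relCharpoly_eq_smul_charpolyRev {𝕂 : Type*} [Field 𝕂] {m : ℕ}
    {D : Matrix (Fin m) (Fin m) 𝕂} (hD : IsUnit D) (E : Matrix (Fin m) (Fin m) 𝕂) :
    relCharpoly D E = C D.det * (D⁻¹ * E).charpolyRev := by
  have hD' := (Matrix.isUnit_iff_isUnit_det _).1 hD
  rw [relCharpoly, Matrix.charpolyRev, RingHom.map_det, ← Matrix.det_mul, mul_sub, mul_one]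
  congr 2
  rw [Matrix.mul_smul]
  congr 1
  change _ = D.map C * (D⁻¹ * E).map C
  rw [← Matrix.map_mul, Matrix.mul_nonsing_inv_cancel_left _ _ hD']

theorem relCharpoly_natDegree_le {𝕂 : Type*} [Field 𝕂] {m : ℕ}
    {D : Matrix (Fin m) (Fin m) 𝕂} (hD : IsUnit D) (E : Matrix (Fin m) (Fin m) 𝕂) :
    (relCharpoly D E).natDegree ≤ m := by
  rw [relCharpoly_eq_smul_charpolyRev hD, ← Matrix.reverse_charpoly]
  refine (natDegree_C_mul_le _ _).trans ((reverse_natDegree_le _).trans ?_)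
  simp [Matrix.charpoly_natDegree_eq_dim]

/-- Cayley–Hamilton for D⁻¹E, multiplied by det D; reversing the polynomial turns the exponent j
into m - j. -/
theorem sum_relCharpoly_smul_pow_eq_zero {𝕂 : Type*} [Field 𝕂] {m : ℕ}
    {D : Matrix (Fin m) (Fin m) 𝕂} (hD : IsUnit D) (E : Matrix (Fin m) (Fin m) 𝕂) :
    ∑ j ∈ Finset.range (m + 1), (relCharpoly D E).coeff j • (D⁻¹ * E) ^ (m - j) = 0 := by
  have hdeg : (D⁻¹ * E).charpoly.natDegree = m := by
    simp [Matrix.charpoly_natDegree_eq_dim]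
  have h := Matrix.aeval_self_charpoly (D⁻¹ * E)
  rw [aeval_eq_sum_range, hdeg, ← Finset.sum_range_reflect] at h
  rw [← smul_zero D.det, ← h, Finset.smul_sum]
  refine Finset.sum_congr rfl fun j hj => ?_
  have hj' : j ≤ m := by simpa [Nat.lt_succ_iff] using hj
  rw [relCharpoly_eq_smul_charpolyRev hD, ← Matrix.reverse_charpoly, coeff_C_mul, coeff_reverse,
    hdeg, revAt_le hj', mul_smul, show m + 1 - 1 - j = m - j by omega]

/-- At indices j ≥ 0 the recurrence is homogeneous, so U_j = (D⁻¹E)^(m-j) U_m, and Cayley–Hamilton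
annihilates the sum. -/
theorem sum_relCharpoly_smul_of_left_recurrence {𝕂 : Type*} [Field 𝕂] {m : ℕ}
    {D E : Matrix (Fin m) (Fin m) 𝕂} (hD : IsUnit D) {U : ℤ → Matrix (Fin m) (Fin m) 𝕂}
    (hU : ∀ k : ℤ, D * U k - E * U (k + 1) = if k = -1 then 1 else 0) :
    ∑ j ∈ Finset.range (m + 1), (relCharpoly D E).coeff j • U j = 0 := by
  have hD' := (Matrix.isUnit_iff_isUnit_det _).1 hD
  have hstep : ∀ j : ℕ, U j = (D⁻¹ * E) * U (j + 1 : ℕ) := fun j => by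
    have h := hU j
    rw [if_neg (by omega), sub_eq_zero] at h
    rw [mul_assoc, Nat.cast_succ, ← h, Matrix.nonsing_inv_mul_cancel_left _ _ hD']
  have hpow : ∀ n j : ℕ, U j = (D⁻¹ * E) ^ n * U (j + n : ℕ) := by
    intro n
    induction n with
    | zero => simp
    | succ n ih =>
      intro j
      rw [ih j, hstep (j + n), pow_succ, mul_assoc, mul_assoc, mul_assoc]
      rfl
  calc _ = ∑ j ∈ Finset.range (m + 1),
        ((relCharpoly D E).coeff j • (D⁻¹ * E) ^ (m - j)) * U m := by
        refine Finset.sum_congr rfl fun j hj => ?_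
        have hj' : j ≤ m := by simpa [Nat.lt_succ_iff] using hj
        rw [smul_mul_assoc, hpow (m - j) j, Nat.add_sub_cancel' hj']
    _ = 0 := by rw [← Finset.sum_mul, sum_relCharpoly_smul_pow_eq_zero hD, zero_mul]

/-! ### Nonsingularity of ∑ p_j V_j. -/

/-- The Laurent coefficients of a pencil `B - λ F` with `F` invertible. -/
theorem laurent_coeff_of_isUnit {𝕂 : Type*} [Field 𝕂] {m μ : ℕ}
    {B F : Matrix (Fin m) (Fin m) 𝕂} (hF : IsUnit F) {V : ℤ → Matrix (Fin m) (Fin m) 𝕂}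
    (h0 : ∀ k : ℤ, k < -(μ : ℤ) → V k = 0)
    (hV : ∀ k : ℤ, B * V k - F * V (k + 1) = if k = -1 then 1 else 0) (j : ℕ) :
    V j = (F⁻¹ * B) ^ j * (-F⁻¹) := by
  have hF' := (Matrix.isUnit_iff_isUnit_det _).1 hF
  have hstep : ∀ k : ℤ, V (k + 1) = F⁻¹ * B * V k - if k = -1 then F⁻¹ else 0 := fun k => by
    have h := congrArg (F⁻¹ * ·) (hV k)
    simp only [mul_sub, Matrix.nonsing_inv_mul_cancel_left _ _ hF', ← mul_assoc, mul_ite, mul_one,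
      mul_zero] at h
    rw [← h]
    abel
  -- Starting from V_(-μ-1) = 0, the upward recurrence keeps V at zero through index -1; the
  -- inhomogeneous term then gives V_0 = -F⁻¹.
  have hneg : ∀ n : ℕ, (n : ℤ) - μ - 1 < 0 → V (n - μ - 1) = 0 := by
    intro n
    induction n with
    | zero => exact fun _ => h0 _ (by omega)
    | succ n ih =>
      intro hn
      have := hstep (n - μ - 1)
      rw [ih (by omega), if_neg (by omega)] at this
      rw [show ((n + 1 : ℕ) : ℤ) - μ - 1 = n - μ - 1 + 1 by push_cast; ring, this]
      simp
  induction j with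
  | zero =>
    have h1 := hneg μ (by omega)
    have := hstep (-1)
    rw [show (-1 : ℤ) = (μ : ℤ) - μ - 1 by ring, h1] at this
    simpa using this
  | succ j ih =>
    rw [Nat.cast_succ, hstep, ih, if_neg (by omega), pow_succ', mul_assoc, sub_zero, mul_assoc,
      mul_assoc]

/-- The eigenvalues of F⁻¹B are the finite eigenvalues of B - λF, so a common root in the algebraic
closure would lie in both spectra. -/
theorem isCoprime_of_pencilSpectrum_inter {𝕂 : Type*} [Field 𝕂] {m : ℕ}
    {A E B F : Matrix (Fin m) (Fin m) 𝕂} (hF : IsUnit F)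
    (hspec : pencilSpectrum A E ∩ pencilSpectrum B F = ∅) :
    IsCoprime (relCharpoly A E) (F⁻¹ * B).charpoly := by
  have hF' := (Matrix.isUnit_iff_isUnit_det _).1 hF
  rw [isCoprime_iff_aeval_ne_zero_of_isAlgClosed 𝕂 (AlgebraicClosure 𝕂)]
  intro z
  by_contra! hz
  obtain ⟨h1, h2⟩ := hz
  have hmem : ((z : AlgebraicClosure 𝕂) : OnePoint (AlgebraicClosure 𝕂)) ∈
      pencilSpectrum A E ∩ pencilSpectrum B F := by
    refine ⟨Or.inr ⟨z, rfl, ?_⟩, Or.inr ⟨z, rfl, ?_⟩⟩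
    · rwa [aeval_def, relCharpoly_map] at h1
    · set φ := algebraMap 𝕂 (AlgebraicClosure 𝕂)
      have h3 : (Matrix.scalar (Fin m) z - (F⁻¹ * B).map φ).det = 0 := by
        rw [← Matrix.eval_charpoly, Matrix.charpoly_map, eval_map]
        exact h2
      have hscalar : z • (1 : Matrix (Fin m) (Fin m) _) = Matrix.scalar (Fin m) z :=
        Matrix.smul_one_eq_diagonal z
      have h4 : B.map φ - z • F.map φ
          = -(F.map φ * (Matrix.scalar (Fin m) z - (F⁻¹ * B).map φ)) := by
        rw [mul_sub, ← Matrix.map_mul, Matrix.mul_nonsing_inv_cancel_left _ _ hF',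
          ← hscalar, Matrix.mul_smul, mul_one, neg_sub]
      rw [h4, Matrix.det_neg, Matrix.det_mul, h3, mul_zero, mul_zero]
  rw [hspec] at hmem
  exact hmem

/-- Evaluating a Bézout identity at H kills the `charpoly` term and leaves an inverse of p(H). -/
theorem isUnit_aeval_of_isCoprime_charpoly {𝕂 : Type*} [Field 𝕂] {m : ℕ} {p : 𝕂[X]}
    {H : Matrix (Fin m) (Fin m) 𝕂} (h : IsCoprime p H.charpoly) : IsUnit (aeval H p) := by
  obtain ⟨a, b, hab⟩ := h
  have := congrArg (aeval H) hab
  rw [map_add, map_mul, map_mul, Matrix.aeval_self_charpoly, mul_zero, add_zero, map_one] at this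
  exact IsUnit.of_mul_eq_one_right _ this

theorem isUnit_sum_relCharpoly_smul {𝕂 : Type*} [Field 𝕂] {m μ : ℕ}
    {A E B F : Matrix (Fin m) (Fin m) 𝕂} (hA : IsUnit A) (hF : IsUnit F)
    (hspec : pencilSpectrum A E ∩ pencilSpectrum B F = ∅)
    {V : ℤ → Matrix (Fin m) (Fin m) 𝕂} (h0 : ∀ k : ℤ, k < -(μ : ℤ) → V k = 0)
    (hV : ∀ k : ℤ, B * V k - F * V (k + 1) = if k = -1 then 1 else 0) :
    IsUnit (∑ j ∈ Finset.range (m + 1), (relCharpoly A E).coeff j • V j) := by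
  have h : ∑ j ∈ Finset.range (m + 1), (relCharpoly A E).coeff j • V j
      = aeval (F⁻¹ * B) (relCharpoly A E) * (-F⁻¹) := by
    rw [aeval_eq_sum_range' (Nat.lt_succ_of_le (relCharpoly_natDegree_le hA E)), Finset.sum_mul]
    exact Finset.sum_congr rfl fun j _ => by
      rw [laurent_coeff_of_isUnit hF h0 hV j, smul_mul_assoc]
  rw [h]
  exact (isUnit_aeval_of_isCoprime_charpoly (isCoprime_of_pencilSpectrum_inter hF hspec)).mul
    ((Matrix.isUnit_nonsing_inv_iff.2 hF).neg)

/-! ### Laurent coefficients of the transformed right-hand side. -/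

/-- Terms outside the original window vanish, so convolutions at different indices can share one
range and be subtracted termwise. -/
theorem convCoeff_eq_sum {𝕂 : Type*} [Field 𝕂] {m μ₁ μ₂ : ℕ}
    {U V : ℤ → Matrix (Fin m) (Fin m) 𝕂} (hU : ∀ k : ℤ, k < -(μ₁ : ℤ) → U k = 0)
    (hV : ∀ k : ℤ, k < -(μ₂ : ℤ) → V k = 0) (M : Matrix (Fin m) (Fin m) 𝕂) {k a b : ℤ}
    (ha : a ≤ -μ₁) (hb : k + μ₂ ≤ b) :
    convCoeff μ₁ μ₂ U V M k = ∑ s ∈ Finset.Icc a b, U s * M * V (k - s) := by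
  refine Finset.sum_subset (Finset.Icc_subset_Icc ha hb) fun s _ hs => ?_
  rw [Finset.mem_Icc, not_and_or, not_le, not_le] at hs
  rcases hs with hs | hs
  · rw [hU s hs, zero_mul, zero_mul]
  · rw [hV (k - s) (by omega), mul_zero]

/-- The Laurent coefficients of `X (B - λ F)⁻¹ + (A - λ E)⁻¹ Y`. -/
theorem rhsCoeff_eq {𝕂 : Type*} [Field 𝕂] {m μ₁ μ₂ : ℕ}
    {A E B F X Y : Matrix (Fin m) (Fin m) 𝕂}
    {U V : ℤ → Matrix (Fin m) (Fin m) 𝕂} (hU : ∀ k : ℤ, k < -(μ₁ : ℤ) → U k = 0)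
    (hV : ∀ k : ℤ, k < -(μ₂ : ℤ) → V k = 0)
    (hU' : ∀ k : ℤ, U k * A - U (k + 1) * E = if k = -1 then 1 else 0)
    (hV' : ∀ k : ℤ, B * V k - F * V (k + 1) = if k = -1 then 1 else 0) (k : ℤ) :
    rhsCoeff μ₁ μ₂ U V (A * X + Y * B) (E * X + Y * F) k = X * V k + U k * Y := by
  -- The window contains every convolution range, has room for a shift by one, and includes the two
  -- surviving indices s = -1 and s = k.
  set a : ℤ := min (-μ₁ - 1) (min (-1) k) with ha
  set b : ℤ := max (k + μ₂) (max (-1) k) with hb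
  have split : ∀ (M N : Matrix (Fin m) (Fin m) 𝕂) (l : ℤ), convCoeff μ₁ μ₂ U V (M + N) l
      = convCoeff μ₁ μ₂ U V M l + convCoeff μ₁ μ₂ U V N l := fun M N l => by
    simp only [convCoeff, mul_add, add_mul, Finset.sum_add_distrib]
  have hshift : convCoeff μ₁ μ₂ U V (E * X) k
      = ∑ s ∈ Finset.Icc a b, U (s + 1) * (E * X) * V (k - 1 - s) := by
    rw [convCoeff_eq_sum hU hV (E * X) (a := a + 1) (b := b + 1) (by omega) (by omega)]
    refine (Finset.sum_equiv (Equiv.addRight (1 : ℤ)) (fun s => ?_) (fun s _ => ?_)).symm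
    · simp
    · simp only [Equiv.coe_addRight]
      rw [show k - 1 - s = k - (s + 1) by ring]
  -- Each term contains U_s A - U_(s+1) E, which vanishes unless s = -1.
  have h1 : convCoeff μ₁ μ₂ U V (A * X) (k - 1) - convCoeff μ₁ μ₂ U V (E * X) k = X * V k := by
    rw [hshift, convCoeff_eq_sum hU hV (A * X) (a := a) (b := b) (by omega) (by omega),
      ← Finset.sum_sub_distrib, Finset.sum_eq_single (-1)]
    · rw [← sub_mul, ← mul_assoc, ← mul_assoc, ← sub_mul, hU', if_pos rfl, one_mul,
        show k - 1 - -1 = k by ring]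
    · intro s _ hs
      rw [← sub_mul, ← mul_assoc, ← mul_assoc, ← sub_mul, hU', if_neg hs, zero_mul, zero_mul]
    · intro h
      exact absurd (Finset.mem_Icc.2 ⟨by omega, by omega⟩) h
  -- Here the recurrence acts on the V side, and only s = k survives.
  have h2 : convCoeff μ₁ μ₂ U V (Y * B) (k - 1) - convCoeff μ₁ μ₂ U V (Y * F) k = U k * Y := by
    have hs' : ∀ s : ℤ, U s * (Y * B) * V (k - 1 - s) - U s * (Y * F) * V (k - s)
        = U s * Y * if k - 1 - s = -1 then 1 else 0 := fun s => by
      rw [← hV' (k - 1 - s), show k - 1 - s + 1 = k - s by ring]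
      noncomm_ring
    rw [convCoeff_eq_sum hU hV (Y * F) (a := a) (b := b) (by omega) (by omega),
      convCoeff_eq_sum hU hV (Y * B) (a := a) (b := b) (by omega) (by omega),
      ← Finset.sum_sub_distrib, Finset.sum_eq_single k]
    · rw [hs', if_pos (by ring), mul_one]
    · intro s _ hs
      rw [hs', if_neg (by omega), mul_zero]
    · intro h
      exact absurd (Finset.mem_Icc.2 ⟨by omega, by omega⟩) h
  rw [rhsCoeff, split, split, ← h1, ← h2]
  abel

theorem sum_relCharpoly_smul_rhsCoeff {𝕂 : Type*} [Field 𝕂] {m μ₁ μ₂ : ℕ}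
    {A E B F X Y : Matrix (Fin m) (Fin m) 𝕂} (hA : IsUnit A)
    {U V : ℤ → Matrix (Fin m) (Fin m) 𝕂} (hU : ∀ k : ℤ, k < -(μ₁ : ℤ) → U k = 0)
    (hV : ∀ k : ℤ, k < -(μ₂ : ℤ) → V k = 0)
    (hUl : ∀ k : ℤ, A * U k - E * U (k + 1) = if k = -1 then 1 else 0)
    (hUr : ∀ k : ℤ, U k * A - U (k + 1) * E = if k = -1 then 1 else 0)
    (hVl : ∀ k : ℤ, B * V k - F * V (k + 1) = if k = -1 then 1 else 0) :
    ∑ j ∈ Finset.range (m + 1), (relCharpoly A E).coeff j •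
        rhsCoeff μ₁ μ₂ U V (A * X + Y * B) (E * X + Y * F) j
      = X * ∑ j ∈ Finset.range (m + 1), (relCharpoly A E).coeff j • V j := by
  simp only [rhsCoeff_eq hU hV hUr hVl, smul_add, Finset.sum_add_distrib]
  rw [← add_zero (X * _), Finset.mul_sum]
  congr 1
  · simp only [mul_smul_comm]
  · simp only [← smul_mul_assoc]
    rw [← Finset.sum_mul, sum_relCharpoly_smul_of_left_recurrence hA hUl, zero_mul]

/-! ### Solvability of the coupled system. -/

/-- A coupled Sylvester system whose homogeneous version has only the trivial solution is
solvable. -/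
theorem exists_coupled_sylvester {𝕂 : Type*} [Field 𝕂] {m : ℕ}
    {A E B F : Matrix (Fin m) (Fin m) 𝕂}
    (hinj : ∀ X Y : Matrix (Fin m) (Fin m) 𝕂, A * X + Y * B = 0 → E * X + Y * F = 0 →
      X = 0 ∧ Y = 0) (M N : Matrix (Fin m) (Fin m) 𝕂) :
    ∃ X Y : Matrix (Fin m) (Fin m) 𝕂, A * X + Y * B = M ∧ E * X + Y * F = N := by
  let T : (Matrix (Fin m) (Fin m) 𝕂 × Matrix (Fin m) (Fin m) 𝕂) →ₗ[𝕂]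
      (Matrix (Fin m) (Fin m) 𝕂 × Matrix (Fin m) (Fin m) 𝕂) :=
    { toFun := fun p => (A * p.1 + p.2 * B, E * p.1 + p.2 * F)
      map_add' := fun p q => by
        ext1 <;> simp only [Prod.fst_add, Prod.snd_add, mul_add, add_mul] <;> abel
      map_smul' := fun c p => by ext1 <;> simp [smul_add] }
  have hT : Function.Injective T := by
    rw [← LinearMap.ker_eq_bot, LinearMap.ker_eq_bot']
    rintro ⟨X, Y⟩ h
    obtain ⟨h1, h2⟩ := Prod.ext_iff.1 h
    obtain ⟨rfl, rfl⟩ := hinj X Y h1 h2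
    rfl
  obtain ⟨⟨X, Y⟩, h⟩ := LinearMap.injective_iff_surjective.1 hT (M, N)
  obtain ⟨h1, h2⟩ := Prod.ext_iff.1 h
  exact ⟨X, Y, h1, h2⟩

/-! ### Existence of Laurent expansions. -/

theorem Polynomial.eval_eq_zpow_mul_eval_reverse {𝕂 : Type*} [Field 𝕂] (p : 𝕂[X]) {z : 𝕂}
    (hz : z ≠ 0) : p.eval z = z ^ (p.natDegree : ℤ) * p.reverse.eval z⁻¹ := by
  let _ := invertibleOfNonzero hz
  have := eval₂_reverse_mul_pow (RingHom.id 𝕂) z p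
  rw [invOf_eq_inv] at this
  rw [zpow_natCast, mul_comm]
  exact this.symm

/-- A rational function has a Laurent expansion at infinity. -/
theorem exists_laurent_rational {𝕂 : Type*} [RCLike 𝕂] (a : 𝕂[X]) {p : 𝕂[X]} (hp : p ≠ 0) :
    ∃ (μ : ℕ) (u : ℤ → 𝕂), (∀ k : ℤ, k < -(μ : ℤ) → u k = 0) ∧
      ∀ᶠ z in Bornology.cobounded 𝕂,
        HasSum (fun k : ℤ => z ^ (-k - 1) * u k) (a.eval z / p.eval z) := by
  -- In y = z⁻¹ the quotient is a power of z times a quotient of reversed polynomials, whose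
  -- denominator at 0 is the leading coefficient of p.
  have han : AnalyticAt 𝕂 (fun y : 𝕂 => a.reverse.eval y / p.reverse.eval y) 0 := by
    refine AnalyticAt.div ?_ ?_ ?_
    · exact (AnalyticAt.aeval_polynomial analyticAt_id a.reverse)
    · exact (AnalyticAt.aeval_polynomial analyticAt_id p.reverse)
    · rw [← coeff_zero_eq_eval_zero, coeff_zero_reverse]
      exact leadingCoeff_ne_zero.2 hp
  obtain ⟨q, hq⟩ := han
  rw [hasFPowerSeriesAt_iff] at hq
  -- Chosen so that z^(-d-1) = z^(deg a - deg p); thus d is the starting index of the expansion.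
  set d : ℤ := p.natDegree - a.natDegree - 1 with hd
  refine ⟨d.natAbs, fun k => if d ≤ k then q.coeff (k - d).toNat else 0,
    fun k hk => if_neg (by omega), ?_⟩
  filter_upwards [Filter.tendsto_inv₀_cobounded.eventually hq, Bornology.eventually_ne_cobounded 0]
    with z hz hz0
  have h1 := hz.mul_left (z ^ (-d - 1))
  have hinj : Function.Injective (fun n : ℕ => (n : ℤ) + d) := fun x y hxy => by
    simpa using hxy
  rw [← hinj.hasSum_iff]
  · refine Eq.mpr (congrArg₂ (HasSum · ·) (funext fun n => ?_) ?_) h1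
    · simp only [Function.comp, smul_eq_mul, ← mul_assoc]
      rw [if_pos (by omega), inv_pow, ← zpow_natCast, ← zpow_neg, ← zpow_add₀ hz0]
      congr 2
      · ring
      · simp
    · rw [zero_add, eval_eq_zpow_mul_eval_reverse a hz0, eval_eq_zpow_mul_eval_reverse p hz0,
        mul_div_mul_comm, ← zpow_sub₀ hz0]
      congr 2
      rw [hd]
      ring
  · intro k hk
    have : ¬ d ≤ k := fun hle => hk ⟨(k - d).toNat, by simp; omega⟩
    simp [this]

/-- By Cramer's rule the entries of the resolvent are rational functions with common denominator
det(D - λE). -/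
theorem PencilRegular.exists_isLaurentExpansion {𝕂 : Type*} [RCLike 𝕂] {m : ℕ}
    {D E : Matrix (Fin m) (Fin m) 𝕂} (h : PencilRegular D E) :
    ∃ (μ : ℕ) (U : ℤ → Matrix (Fin m) (Fin m) 𝕂), IsLaurentExpansion D E μ U := by
  have hp := h.relCharpoly_ne_zero
  set Q : Matrix (Fin m) (Fin m) 𝕂[X] :=
    (D.map (C : 𝕂 →+* 𝕂[X]) - (X : 𝕂[X]) • E.map (C : 𝕂 →+* 𝕂[X])).adjugate with hQ
  choose ν u hu hsum using fun i j => exists_laurent_rational (Q i j) hp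
  have hadj : ∀ (z : 𝕂) i j, (Q i j).eval z = (D - z • E).adjugate i j := by
    intro z i j
    have := (evalRingHom z).map_adjugate
      (D.map (C : 𝕂 →+* 𝕂[X]) - (X : 𝕂[X]) • E.map (C : 𝕂 →+* 𝕂[X]))
    have h2 : (evalRingHom z).mapMatrix
      (D.map (C : 𝕂 →+* 𝕂[X]) - (X : 𝕂[X]) • E.map (C : 𝕂 →+* 𝕂[X])) = D - z • E := by
      ext i j
      simp [mul_comm z]
    rw [h2] at this
    rw [← this]
    rfl
  -- The sum of the entrywise orders bounds each of them.
  refine ⟨∑ i, ∑ j, ν i j, fun k => Matrix.of fun i j => u i j k, ⟨fun k hk => ?_, ?_⟩⟩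
  · ext i j
    refine hu i j k (hk.trans_le (neg_le_neg ?_))
    have h1 : ν i j ≤ ∑ j, ν i j := Finset.single_le_sum (fun _ _ => Nat.zero_le _)
      (Finset.mem_univ j)
    have h2 : ∑ j, ν i j ≤ ∑ i, ∑ j, ν i j :=
      Finset.single_le_sum (f := fun i => ∑ j, ν i j) (fun _ _ => Nat.zero_le _)
        (Finset.mem_univ i)
    exact_mod_cast h1.trans h2
  · have hroot : ∀ᶠ z in Bornology.cobounded 𝕂, (relCharpoly D E).eval z ≠ 0 := by
      have hfin : {z | (relCharpoly D E).IsRoot z}.Finite := finite_setOfPred_isRoot hp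
      exact Bornology.isBounded_def.1 hfin.isBounded
    have hall : ∀ᶠ z in Bornology.cobounded 𝕂, ∀ i j, HasSum (fun k : ℤ => z ^ (-k - 1) * u i j k)
        ((Q i j).eval z / (relCharpoly D E).eval z) :=
      Filter.eventually_all.2 fun i => Filter.eventually_all.2 fun j => hsum i j
    obtain ⟨R, -, hR⟩ := (Filter.hasBasis_cobounded_norm (E := 𝕂)).eventually_iff.1 (hroot.and hall)
    refine ⟨R, fun z hz => ?_⟩
    obtain ⟨h1, h2⟩ := hR hz.le
    rw [relCharpoly_eval] at h1
    refine ⟨(Matrix.isUnit_iff_isUnit_det _).2 (isUnit_iff_ne_zero.2 h1), ?_⟩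
    refine Pi.hasSum.2 fun i => Pi.hasSum.2 fun j => ?_
    refine Eq.mpr (congrArg (HasSum (fun k : ℤ => z ^ (-k - 1) * u i j k)) ?_) (h2 i j)
    rw [hadj, relCharpoly_eval, Matrix.inv_def, Ring.inverse_eq_inv', Matrix.smul_apply,
      smul_eq_mul, div_eq_inv_mul]

/-! ### The equation AX + f(X)B = C. -/

theorem mainTheorem2 {𝕂 : Type*} [RCLike 𝕂] (m : ℕ)
    (f : Matrix (Fin m) (Fin m) 𝕂 → Matrix (Fin m) (Fin m) 𝕂) (s : 𝕂 → 𝕂)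
    (hf_period : ∀ M, f (f M) = M)
    (hf_reversing : ∀ M N, f (M * N) = f N * f M)
    (hf_add : ∀ M N, f (M + N) = f M + f N)
    (hf_smul : ∀ (a : 𝕂) (M), f (a • M) = s a • f M)
    (hs : Function.Injective s)
    (hf_unit : ∀ M, IsUnit M → IsUnit (f M))
    (A B C : Matrix (Fin m) (Fin m) 𝕂)
    (hreg₁ : PencilRegular A (f B)) (hreg₂ : PencilRegular B (f A))
    (hspec : pencilSpectrum A (f B) ∩ pencilSpectrum B (f A) = ∅)
    (hA : IsUnit A) :
    (∃ (μ₁ : ℕ) (U : ℤ → Matrix (Fin m) (Fin m) 𝕂), IsLaurentExpansion A (f B) μ₁ U) ∧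
    (∃ (μ₂ : ℕ) (V : ℤ → Matrix (Fin m) (Fin m) 𝕂), IsLaurentExpansion B (f A) μ₂ V) ∧
    ∀ (μ₁ μ₂ : ℕ) (U V : ℤ → Matrix (Fin m) (Fin m) 𝕂),
      IsLaurentExpansion A (f B) μ₁ U → IsLaurentExpansion B (f A) μ₂ V →
      IsUnit (relCharEval A (f B) V m) ∧
      ∀ X : Matrix (Fin m) (Fin m) 𝕂,
        A * X + f X * B = C ↔
          X = (∑ j ∈ Finset.range (m + 1),
                (relCharpoly A (f B)).coeff j • rhsCoeff μ₁ μ₂ U V C (f C) j) *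
              (relCharEval A (f B) V m)⁻¹ := by
  have hF : IsUnit (f A) := hf_unit A hA
  refine ⟨hreg₁.exists_isLaurentExpansion, hreg₂.exists_isLaurentExpansion, ?_⟩
  intro μ₁ μ₂ U V hU hV
  have heval : relCharEval A (f B) V m
      = ∑ j ∈ Finset.range (m + 1), (relCharpoly A (f B)).coeff j • V j :=
    Finset.sum_congr rfl fun j _ => by rw [add_sub_cancel_left]
  have hunit : IsUnit (relCharEval A (f B) V m) := by
    rw [heval]
    exact isUnit_sum_relCharpoly_smul hA hF hspec hV.eq_zero hV.left_recurrence
  have hdet := (Matrix.isUnit_iff_isUnit_det _).1 hunit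
  -- Y need not be f(X) here: the formula for X is also applied to the homogeneous system and to the
  -- swapped pair (f(Y), f(X)).
  have huniq : ∀ X Y M N : Matrix (Fin m) (Fin m) 𝕂, A * X + Y * B = M → f B * X + Y * f A = N →
      X = (∑ j ∈ Finset.range (m + 1),
        (relCharpoly A (f B)).coeff j • rhsCoeff μ₁ μ₂ U V M N j) *
          (relCharEval A (f B) V m)⁻¹ := by
    rintro X Y _ _ rfl rfl
    rw [sum_relCharpoly_smul_rhsCoeff hA hU.eq_zero hV.eq_zero hU.left_recurrence
      hU.right_recurrence hV.left_recurrence, ← heval, Matrix.mul_nonsing_inv_cancel_right _ _ hdet]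
  have hright : ∀ X Y Y' : Matrix (Fin m) (Fin m) 𝕂,
      f B * X + Y * f A = f B * X + Y' * f A → Y = Y' := fun X Y Y' h =>
    hF.mul_left_injective (add_left_cancel h)
  have hinj : ∀ X Y : Matrix (Fin m) (Fin m) 𝕂, A * X + Y * B = 0 → f B * X + Y * f A = 0 →
      X = 0 ∧ Y = 0 := by
    intro X Y h1 h2
    obtain rfl : X = 0 := (huniq X Y 0 0 h1 h2).trans (huniq 0 0 0 0 (by simp) (by simp)).symm
    exact ⟨rfl, hright 0 Y 0 (by rw [h2]; simp)⟩
  have hdual : ∀ X : Matrix (Fin m) (Fin m) 𝕂, A * X + f X * B = C →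
      f B * X + f X * f A = f C := by
    rintro X rfl
    rw [hf_add, hf_reversing, hf_reversing, hf_period, add_comm]
  refine ⟨hunit, fun X => ⟨fun h => huniq X (f X) C (f C) h (hdual X h), ?_⟩⟩
  rintro rfl
  obtain ⟨X, Y, h1, h2⟩ := exists_coupled_sylvester hinj C (f C)
  -- f interchanges the two equations of the system, so (f(Y), f(X)) is again a solution.
  have h1' : A * f Y + f X * B = C := by
    rw [← hf_period C, ← h2, hf_add, hf_reversing, hf_reversing, hf_period, hf_period, add_comm]
  have h2' : f B * f Y + f X * f A = f C := by
    rw [← h1, hf_add, hf_reversing, hf_reversing, add_comm]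
  have hXY : X = f Y := (huniq _ _ _ _ h1 h2).trans (huniq _ _ _ _ h1' h2').symm
  rw [← huniq X Y C (f C) h1 h2]
  rwa [← hXY] at h1'
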